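/- Let $1\le S\le N$ and let $\mathcal X_S=\{x\in\mathbb R^N : \|x\|_0\le S\}$ be the set of $S$-sparse vectors ($\|x\|_0$ being the number of nonzero entries). Let $\sigma>0$, and let $H\in\mathbb R^{M\times N}$ satisfy $\operatorname{spark}(H)>S$, i.e., any $S$ columns of $H$ are linearly independent. Consider the sparse linear Gaussian model, in which $y\in\mathbb R^M$ has the density $$f_H(y;x)=\frac{1}{(2\pi\sigma^2)^{M/2}}\exp\Big(-\frac{1}{2\sigma^2}\|y-Hx\|_2^2\Big),\qquad x\in\mathcal X_S,$$ and let $g:\mathcal X_S\to\mathbb R$ be an arbitrary function. A function $c:\mathcal X_S\to\mathbb R$ is called a valid bias function at $x_0\in\mathcal X_S$ if there is an estimator, i.e., a measurable function $\hat g:\mathbb R^M\to\mathbb R$, whose mean $\mathsf E_x\{\hat g(y)\}$ exists and satisfies $\mathsf E_x\{\hat g(y)\}-g(x)=c(x)$ for all $x\in\mathcal X_S$, and whose variance at $x_0$ is finite. Let $D=\operatorname{rank}(H)$, let $H=U\Sigma V^T$ be a thin singular value decomposition ($U\in\mathbb R^{M\times D}$, $V\in\mathbb R^{N\times D}$, $U^TU=V^TV=I$,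 $\Sigma\in\mathbb R^{D\times D}$ diagonal with positive diagonal entries), put $\widetilde H=V\Sigma^{-1}$, and let $\widetilde H^\dagger$ be its Moore–Penrose pseudoinverse. Then, for every $x_0\in\mathcal X_S$, a function $c:\mathcal X_S\to\mathbb R$ is a valid bias function at $x_0$ if and only if there is a real sequence $a\in\ell^2(\mathbb Z_+^D)$ such that $$c(x)=\exp\Big(\frac{1}{2\sigma^2}\|Hx_0\|_2^2-\frac{1}{\sigma^2}x^TH^THx_0\Big)\sum_{p\in\mathbb Z_+^D}\frac{a[p]}{\sqrt{p!}}\Big(\frac1\sigma\widetilde H^\dagger x\Big)^p-g(x)\qquad\text{for all }x\in\mathcal X_S,$$ where $p!=\prod_l p_l!$ and $z^p=\prod_l z_l^{p_l}$ (the series converges absolutely for every $a\in\ell^2(\mathbb Z_+^D)$ and every $x$). -/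

import Mathlib

/-! ### Real matrices: pseudoinverse, spark, thin singular value decomposition -/

/-- The four Penrose equations: `B` is the Moore-Penrose pseudoinverse of the real matrix `A`. -/
structure IsMoorePenroseInverse {m n : ℕ} (A : Matrix (Fin m) (Fin n) ℝ)
    (B : Matrix (Fin n) (Fin m) ℝ) : Prop where
  mul_mul_left : A * B * A = A
  mul_mul_right : B * A * B = B
  symm_left : (A * B).transpose = A * B
  symm_right : (B * A).transpose = B * A

theorem exists_isMoorePenroseInverse {m n : ℕ} (A : Matrix (Fin m) (Fin n) ℝ) :
    ∃ B, IsMoorePenroseInverse A B := by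
  have hG : (A.transpose * A).IsHermitian := by
    rw [← Matrix.conjTranspose_eq_transpose_of_trivial]
    exact Matrix.isHermitian_conjTranspose_mul_self A
  obtain ⟨W, d, hW, hGd⟩ : ∃ (W : Matrix (Fin n) (Fin n) ℝ) (d : Fin n → ℝ),
      W.transpose * W = 1 ∧ A.transpose * A = W * Matrix.diagonal d * W.transpose := by
    refine ⟨(hG.eigenvectorUnitary : Matrix (Fin n) (Fin n) ℝ), hG.eigenvalues, ?_, ?_⟩
    · have := Unitary.coe_star_mul_self hG.eigenvectorUnitary
      simpa [Matrix.star_eq_conjTranspose] using this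
    · have := hG.spectral_theorem
      simpa [Unitary.conjStarAlgAut_apply, Matrix.star_eq_conjTranspose, Function.comp_def] using this
  set K := W * Matrix.diagonal (fun i => (d i)⁻¹) * W.transpose with hK
  have hKt : K.transpose = K := by
    simp [hK, Matrix.transpose_mul, Matrix.mul_assoc]
  have hKG : K * (A.transpose * A) = W * Matrix.diagonal (fun i => (d i)⁻¹ * d i) * W.transpose := by
    rw [hGd, hK]
    calc _ = W * Matrix.diagonal (fun i => (d i)⁻¹) * (W.transpose * W) * Matrix.diagonal d
          * W.transpose := by simp only [Matrix.mul_assoc]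
      _ = _ := by rw [hW, Matrix.mul_one, Matrix.mul_assoc W, Matrix.diagonal_mul_diagonal]
  have hKGK : K * (A.transpose * A) * K = K := by
    rw [hKG, hK]
    calc _ = W * Matrix.diagonal (fun i => (d i)⁻¹ * d i) * (W.transpose * W)
          * Matrix.diagonal (fun i => (d i)⁻¹) * W.transpose := by simp only [Matrix.mul_assoc]
      _ = _ := by
        rw [hW, Matrix.mul_one, Matrix.mul_assoc W, Matrix.diagonal_mul_diagonal]
        congr 3
        ext i
        by_cases h : d i = 0 <;> simp [h]
  have hGKG : A.transpose * A * (K * (A.transpose * A)) = A.transpose * A := by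
    rw [hKG, hGd]
    calc _ = W * Matrix.diagonal d * (W.transpose * W)
          * Matrix.diagonal (fun i => (d i)⁻¹ * d i) * W.transpose := by simp only [Matrix.mul_assoc]
      _ = _ := by
        rw [hW, Matrix.mul_one, Matrix.mul_assoc W, Matrix.diagonal_mul_diagonal]
        congr 3
        ext i
        by_cases h : d i = 0 <;> simp [h]
  refine ⟨K * A.transpose, ?_, ?_, ?_, ?_⟩
  · have h0 : (A * (K * (A.transpose * A)) - A).transpose *
        (A * (K * (A.transpose * A)) - A) = 0 := by
      have h1 : A.transpose * (A * (K * (A.transpose * A)) - A) = 0 := by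
        rw [Matrix.mul_sub, ← Matrix.mul_assoc, hGKG, sub_self]
      have h2 : (A * (K * (A.transpose * A)) - A).transpose
          = (K * (A.transpose * A) - 1).transpose * A.transpose := by
        rw [← Matrix.transpose_mul, Matrix.mul_sub, Matrix.mul_one]
      rw [h2, Matrix.mul_assoc, h1, Matrix.mul_zero]
    rw [← Matrix.conjTranspose_eq_transpose_of_trivial,
      Matrix.conjTranspose_mul_self_eq_zero] at h0
    have h3 := sub_eq_zero.mp h0
    simpa only [Matrix.mul_assoc] using h3
  · calc K * A.transpose * A * (K * A.transpose)
        = K * (A.transpose * A) * K * A.transpose := by simp only [Matrix.mul_assoc]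
      _ = _ := by rw [hKGK]
  · simp [Matrix.transpose_mul, hKt, Matrix.mul_assoc]
  · rw [Matrix.mul_assoc, hKG]
    simp [Matrix.transpose_mul, Matrix.mul_assoc]

/-- The Moore-Penrose pseudoinverse of a real matrix. -/
noncomputable def pinv {m n : ℕ} (A : Matrix (Fin m) (Fin n) ℝ) : Matrix (Fin n) (Fin m) ℝ :=
  (exists_isMoorePenroseInverse A).choose

theorem pinv_spec {m n : ℕ} (A : Matrix (Fin m) (Fin n) ℝ) : IsMoorePenroseInverse A (pinv A) :=
  (exists_isMoorePenroseInverse A).choose_spec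

/-- The spark of `H`: the minimum number of linearly dependent columns
(`⊤` if all the columns together are linearly independent). -/
noncomputable def spark {M N : ℕ} (H : Matrix (Fin M) (Fin N) ℝ) : ℕ∞ :=
  ⨅ I : {I : Finset (Fin N) // ¬ LinearIndepOn ℝ H.col (I : Set (Fin N))}, (I.1.card : ℕ∞)

/-- `H = U Σ Vᵀ` is a thin singular value decomposition, with `Σ = diag s`
of size `D = rank H`. -/
structure IsThinSVD {M N D : ℕ} (H : Matrix (Fin M) (Fin N) ℝ) (U : Matrix (Fin M) (Fin D) ℝ)
    (s : Fin D → ℝ) (V : Matrix (Fin N) (Fin D) ℝ) : Prop where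
  rank_eq : D = H.rank
  orthonormal_left : U.transpose * U = 1
  orthonormal_right : V.transpose * V = 1
  pos : ∀ k, 0 < s k
  eq_mul : H = U * Matrix.diagonal s * V.transpose

/-- The action of a matrix on Euclidean vectors. -/
noncomputable def matVec {m n : ℕ} (A : Matrix (Fin m) (Fin n) ℝ) (x : EuclideanSpace ℝ (Fin n)) :
    EuclideanSpace ℝ (Fin m) :=
  WithLp.toLp 2 (A.mulVec x.ofLp)

/-! ### Estimation problems and valid bias functions -/

/-- The law of the observation with density `f · x` with respect to `volume`. -/
noncomputable def observationLaw {E Y : Type*} [MeasureTheory.MeasureSpace Y] (f : Y → E → ℝ)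
    (x : E) : MeasureTheory.Measure Y :=
  MeasureTheory.volume.withDensity (fun y => ENNReal.ofReal (f y x))

/-- The estimator `ghat` belongs to the set of allowed estimators for the problem with parameter
set `X`, statistical model `f` and parameter function `g`, at `x₀`, with prescribed bias `c`:
its mean exists on `X`, its variance at `x₀` is finite, and its bias is `c` on `X`. -/
structure IsAllowedEstimator {E Y : Type*} [MeasureTheory.MeasureSpace Y] (X : Set E)
    (f : Y → E → ℝ) (g c : X → ℝ) (x₀ : X) (ghat : Y → ℝ) : Prop where
  measurable : Measurable ghat
  integrable : ∀ x : X, MeasureTheory.Integrable ghat (observationLaw f (x : E))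
  variance_lt_top : ProbabilityTheory.evariance ghat (observationLaw f (x₀ : E)) < ⊤
  bias_eq : ∀ x : X, (∫ y, ghat y ∂(observationLaw f (x : E))) - g x = c x

/-- The bias function `c` is valid at `x₀`: there is an allowed estimator. -/
def IsValidBias {E Y : Type*} [MeasureTheory.MeasureSpace Y] (X : Set E) (f : Y → E → ℝ)
    (g c : X → ℝ) (x₀ : X) : Prop :=
  ∃ ghat : Y → ℝ, IsAllowedEstimator X f g c x₀ ghat

/-! ### The sparse linear Gaussian model -/

/-- The set of `S`-sparse vectors (at most `S` nonzero entries). -/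
def sparseVectors (N S : ℕ) : Set (EuclideanSpace ℝ (Fin N)) :=
  {x | hammingNorm x.ofLp ≤ S}

/-- The density of `y = H x + n`, with `n` centred Gaussian of covariance `σ² I`. -/
noncomputable def gaussianModel {M N : ℕ} (H : Matrix (Fin M) (Fin N) ℝ) (σ : ℝ)
    (y : EuclideanSpace ℝ (Fin M)) (x : EuclideanSpace ℝ (Fin N)) : ℝ :=
  1 / (2 * Real.pi * σ ^ 2) ^ ((M : ℝ) / 2) *
    Real.exp (-(1 / (2 * σ ^ 2)) * ‖y - matVec H x‖ ^ 2)

/-! ### Multi-indices and the power series -/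

/-- `p! = ∏ p_l!` -/
def multiFactorial {D : ℕ} (p : Fin D → ℕ) : ℕ := ∏ l, (p l).factorial

/-- `z ^ p = ∏ z_l ^ p_l` -/
noncomputable def multiPow {D : ℕ} (z : EuclideanSpace ℝ (Fin D)) (p : Fin D → ℕ) : ℝ :=
  ∏ l, z l ^ p l

/-- The series `∑ a[p] / √(p!) z ^ p` converges (absolutely) for all square-summable `a` and
all `z`. -/
theorem summable_multiSeries {D : ℕ} (a : lp (fun _ : Fin D → ℕ => ℝ) 2)
    (z : EuclideanSpace ℝ (Fin D)) :
    Summable (fun p : Fin D → ℕ => a p / √(multiFactorial p : ℝ) * multiPow z p) := by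
  have ha : Summable (fun p => a p ^ 2) := by
    have := (lp.memℓp a).summable (by norm_num)
    simpa using this
  have hb : Summable (fun p : Fin D → ℕ => (multiPow z p / √(multiFactorial p : ℝ)) ^ 2) := by
    have he : ∀ p : Fin D → ℕ, (multiPow z p / √(multiFactorial p : ℝ)) ^ 2
        = ∏ l, (z l ^ 2) ^ p l / (p l).factorial := by
      intro p
      rw [div_pow, Real.sq_sqrt (Nat.cast_nonneg _), multiPow, multiFactorial,
        ← Finset.prod_pow, Nat.cast_prod, ← Finset.prod_div_distrib]
      refine Finset.prod_congr rfl fun l _ => ?_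
      rw [← pow_mul, ← pow_mul, mul_comm]
    simp_rw [he]
    refine summable_of_sum_le (c := ∏ l, Real.exp (z l ^ 2))
      (fun p => Finset.prod_nonneg fun l _ => by positivity) fun u => ?_
    obtain ⟨n, hn⟩ : ∃ n, ∀ p ∈ u, ∀ l, p l < n := by
      refine ⟨(u.sup fun p => ∑ l, p l) + 1, fun p hp l => Nat.lt_succ_of_le ?_⟩
      exact (Finset.single_le_sum (f := p) (fun _ _ => Nat.zero_le _) (Finset.mem_univ l)).trans
        (Finset.le_sup (f := fun p : Fin D → ℕ => ∑ l, p l) hp)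
    calc _ ≤ ∑ p ∈ Fintype.piFinset (fun _ : Fin D => Finset.range n),
          ∏ l, (z l ^ 2) ^ p l / (p l).factorial := by
          refine Finset.sum_le_sum_of_subset_of_nonneg (fun p hp => ?_)
            (fun p _ _ => Finset.prod_nonneg fun l _ => by positivity)
          simpa using hn p hp
      _ = ∏ l, ∑ k ∈ Finset.range n, (z l ^ 2) ^ k / k.factorial :=
          (Finset.prod_univ_sum (fun _ : Fin D => Finset.range n)
            (fun l k => (z l ^ 2) ^ k / (k.factorial : ℝ))).symm
      _ ≤ _ := Finset.prod_le_prod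
          (fun l _ => Finset.sum_nonneg fun k _ => by positivity)
          (fun l _ => Real.sum_le_exp_of_nonneg (sq_nonneg _) n)
  refine Summable.of_norm_bounded (ha.add hb) fun p => ?_
  rw [div_mul_eq_mul_div, mul_div_assoc, norm_mul, Real.norm_eq_abs, Real.norm_eq_abs]
  nlinarith [sq_abs (a p), sq_abs (multiPow z p / √(multiFactorial p : ℝ)),
    sq_nonneg (|a p| - |multiPow z p / √(multiFactorial p : ℝ)|),
    sq_nonneg (|a p|), sq_nonneg (|multiPow z p / √(multiFactorial p : ℝ)|)]

/-- The sum `∑ a[p] / √(p!) z ^ p` over all multi-indices `p`. -/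
noncomputable def multiSeries {D : ℕ} (a : lp (fun _ : Fin D → ℕ => ℝ) 2)
    (z : EuclideanSpace ℝ (Fin D)) : ℝ :=
  ∑' p : Fin D → ℕ, a p / √(multiFactorial p : ℝ) * multiPow z p

/-! Weighting by the likelihood ratio `ρ_x` of `x` to `x₀` turns a mean under `x` into a mean under
`x₀`, and finite variance at `x₀` means membership in `L²` of the law at `x₀`. So `c` is valid
exactly when `c + g` has the form `x ↦ ⟨ρ_x, u⟩` with `u` in that space
(`isValidBias_gaussianModel_iff`).

Completing the square gives `⟨ρ_{x₁}, ρ_{x₂}⟩ = exp(σ⁻²⟨H(x₁ - x₀), H(x₂ - x₀)⟩)`. This splits as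
`k(x₁) k(x₂) exp⟨w(x₁), w(x₂)⟩`, where `w(x)` is the argument of the power series and `k(x)` the
exponential prefactor. By the exponential series it is also the Gram matrix of the vectors `k(x)
(w(x)^p / √p!)_p` of `ℓ²`. Families with equal Gram matrices give the same functions `x ↦ ⟨·, u⟩`
(`exists_forall_inner_eq_of_gram_eq`), and pairing the second family with `a` is the asserted
series. -/

/-- If two families in real inner product spaces have the same Gram matrix, then every family of
inner products of the first with a fixed vector is also one of the second. -/
theorem exists_forall_inner_eq_of_gram_eq {ι E F : Type*} [NormedAddCommGroup E]
    [InnerProductSpace ℝ E] [NormedAddCommGroup F] [InnerProductSpace ℝ F] [CompleteSpace F]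
    {a : ι → E} {b : ι → F} (h : ∀ i j, inner ℝ (a i) (a j) = inner ℝ (b i) (b j)) (u : E) :
    ∃ v : F, ∀ i, inner ℝ (a i) u = inner ℝ (b i) v := by
  set A : (ι →₀ ℝ) →ₗ[ℝ] E := Finsupp.linearCombination ℝ a with hA
  set B : (ι →₀ ℝ) →ₗ[ℝ] F := Finsupp.linearCombination ℝ b with hB
  have hAB : ∀ w, ‖A w‖ = ‖B w‖ := fun w => by
    rw [← sq_eq_sq₀ (norm_nonneg _) (norm_nonneg _), ← real_inner_self_eq_norm_sq,
      ← real_inner_self_eq_norm_sq, hA, hB]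
    simp only [Finsupp.linearCombination_apply, Finsupp.sum, sum_inner, inner_sum,
      real_inner_smul_left, real_inner_smul_right, h]
  set f : (ι →₀ ℝ) →ₗ[ℝ] ℝ := (innerSL ℝ u).toLinearMap ∘ₗ A with hf
  -- The bound makes `f` factor through `B` as a bounded functional on the range of `B`; Hahn-Banach
  -- extends it to `F`, and Riesz represents the extension by a vector.
  have hbd : ∃ C : ℝ, ∀ w, ‖f w‖ ≤ C * ‖B w‖ := ⟨‖u‖, fun w => by
    rw [← hAB]
    exact norm_inner_le_norm u (A w)⟩
  obtain ⟨φ, hφ, -⟩ := exists_extension_norm_eq _ (f.compLeftInverse B)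
  refine ⟨(InnerProductSpace.toDual ℝ F).symm φ, fun i => ?_⟩
  have hBi : B (Finsupp.single i 1) = b i := by simp [hB]
  have h1 := hφ ⟨b i, ⟨_, hBi⟩⟩
  rw [LinearMap.compLeftInverse_apply_of_bdd _ _ hbd _ _ hBi] at h1
  rw [real_inner_comm _ (b i), InnerProductSpace.toDual_symm_apply, real_inner_comm]
  simpa [hf, hA] using h1.symm

/-! ### The multivariate exponential series -/

theorem hasSum_prod_pow_div_factorial {D : ℕ} (t : Fin D → ℝ) :
    HasSum (fun p : Fin D → ℕ => ∏ l, t l ^ p l / (p l).factorial) (Real.exp (∑ l, t l)) := by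
  -- Absolute summability is carried through the induction because the product of two series needs
  -- it.
  have habs : ∀ (D : ℕ) (t : Fin D → ℝ),
      HasSum (fun p : Fin D → ℕ => ∏ l, t l ^ p l / (p l).factorial) (Real.exp (∑ l, t l)) ∧
      Summable (fun p : Fin D → ℕ => ‖∏ l, t l ^ p l / ((p l).factorial : ℝ)‖) := by
    intro D
    induction D with
    | zero =>
      intro t
      refine ⟨?_, Summable.of_finite⟩
      simp
    | succ D ih =>
      intro t
      obtain ⟨h1, h2⟩ := ih (fun l => t l.succ)
      have h0 : HasSum (fun k : ℕ => t 0 ^ k / (k.factorial : ℝ)) (Real.exp (t 0)) := by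
        rw [Real.exp_eq_exp_ℝ]
        exact NormedSpace.expSeries_div_hasSum_exp (t 0)
      have h0' : Summable fun k : ℕ => ‖t 0 ^ k / (k.factorial : ℝ)‖ :=
        NormedSpace.norm_expSeries_div_summable (t 0)
      have hs := summable_mul_of_summable_norm h0' h2
      have hm := h0.mul h1 hs
      have hn := h0'.mul_norm h2
      rw [← (Fin.consEquiv fun _ : Fin (D + 1) => ℕ).hasSum_iff,
        ← (Fin.consEquiv fun _ : Fin (D + 1) => ℕ).summable_iff]
      constructor
      · rw [Fin.sum_univ_succ, Real.exp_add]
        refine hm.congr_fun fun x => ?_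
        simp only [Function.comp_apply, Fin.consEquiv, Equiv.coe_fn_mk, Fin.prod_univ_succ,
          Fin.cons_zero, Fin.cons_succ]
      · refine hn.congr fun x => ?_
        simp only [Function.comp_apply, Fin.consEquiv, Equiv.coe_fn_mk, Fin.prod_univ_succ,
          Fin.cons_zero, Fin.cons_succ]
  exact (habs D t).1

/-! ### The pseudoinverse and the singular value decomposition -/

theorem pinv_mul_inv_diagonal {N D : ℕ} {V : Matrix (Fin N) (Fin D) ℝ} {s : Fin D → ℝ}
    (hV : V.transpose * V = 1) (hs : ∀ k, 0 < s k) :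
    pinv (V * (Matrix.diagonal s)⁻¹) = Matrix.diagonal s * V.transpose := by
  obtain ⟨h1, -, h3, -⟩ := pinv_spec (V * (Matrix.diagonal s)⁻¹)
  set A := V * (Matrix.diagonal s)⁻¹ with hA
  set B := pinv A
  set C := Matrix.diagonal s * V.transpose with hC
  have hdet : IsUnit (Matrix.diagonal s).det := by
    rw [Matrix.det_diagonal]
    exact (Finset.prod_pos fun k _ => hs k).ne'.isUnit
  have hCA : C * A = 1 := by
    rw [hC, hA, Matrix.mul_assoc, ← Matrix.mul_assoc V.transpose, hV, Matrix.one_mul,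
      Matrix.mul_nonsing_inv _ hdet]
  have hAC : A * C = V * V.transpose := by
    rw [hC, hA, Matrix.mul_assoc, ← Matrix.mul_assoc _ (Matrix.diagonal s),
      Matrix.nonsing_inv_mul _ hdet, Matrix.one_mul]
  have hACt : (A * C).transpose = A * C := by simp [hAC]
  have h4 : A * B * (A * C) = A * C := by rw [← Matrix.mul_assoc, h1]
  -- Both products are the orthogonal projection onto the range of `A`: transposing `h4` gives `ACAB
  -- = AC`, while `CA = 1` gives `ACAB = AB`.
  have h5 : A * B = A * C := by
    have := congrArg Matrix.transpose h4
    rw [Matrix.transpose_mul, h3, hACt] at this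
    rwa [Matrix.mul_assoc A C, ← Matrix.mul_assoc C, hCA, Matrix.one_mul] at this
  calc B = C * A * B := by rw [hCA, Matrix.one_mul]
    _ = C := by rw [Matrix.mul_assoc, h5, ← Matrix.mul_assoc, hCA, Matrix.one_mul]

theorem inner_matVec_matVec {m n : ℕ} (A : Matrix (Fin m) (Fin n) ℝ)
    (x y : EuclideanSpace ℝ (Fin n)) :
    inner ℝ (matVec A x) (matVec A y) = x.ofLp ⬝ᵥ (A.transpose * A).mulVec y.ofLp := by
  rw [← Matrix.mulVec_mulVec, Matrix.dotProduct_mulVec, Matrix.vecMul_transpose]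
  simp [matVec, EuclideanSpace.inner_eq_star_dotProduct, dotProduct_comm]

theorem matVec_add {m n : ℕ} (A : Matrix (Fin m) (Fin n) ℝ) (x y : EuclideanSpace ℝ (Fin n)) :
    matVec A (x + y) = matVec A x + matVec A y := by
  ext i; simp [matVec, Matrix.mulVec_add]

theorem matVec_sub {m n : ℕ} (A : Matrix (Fin m) (Fin n) ℝ) (x y : EuclideanSpace ℝ (Fin n)) :
    matVec A (x - y) = matVec A x - matVec A y := by
  ext i; simp [matVec, Matrix.mulVec_sub]

/-- Both Gram matrices equal `V Σ² Vᵀ`, since `Uᵀ U = 1`. This is all that the main proof needs from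
the decomposition. -/
theorem IsThinSVD.inner_matVec_pinv {M N D : ℕ} {H : Matrix (Fin M) (Fin N) ℝ}
    {U : Matrix (Fin M) (Fin D) ℝ} {s : Fin D → ℝ} {V : Matrix (Fin N) (Fin D) ℝ}
    (h : IsThinSVD H U s V) (x y : EuclideanSpace ℝ (Fin N)) :
    inner ℝ (matVec (pinv (V * (Matrix.diagonal s)⁻¹)) x)
      (matVec (pinv (V * (Matrix.diagonal s)⁻¹)) y) = inner ℝ (matVec H x) (matVec H y) := by
  rw [inner_matVec_matVec, inner_matVec_matVec, pinv_mul_inv_diagonal h.orthonormal_right h.pos,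
    h.eq_mul, Matrix.mul_assoc U, Matrix.transpose_mul U, Matrix.mul_assoc _ U.transpose,
    ← Matrix.mul_assoc U.transpose, h.orthonormal_left, Matrix.one_mul]

/-! ### The exponential kernel as a Gram matrix in `ℓ²` -/

theorem hasSum_multiPow_mul_multiPow {D : ℕ} (z w : EuclideanSpace ℝ (Fin D)) :
    HasSum (fun p : Fin D → ℕ => multiPow z p / √(multiFactorial p : ℝ) *
      (multiPow w p / √(multiFactorial p : ℝ))) (Real.exp (inner ℝ z w)) := by
  convert hasSum_prod_pow_div_factorial (fun l => z l * w l) using 1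
  · ext p
    rw [div_mul_div_comm, Real.mul_self_sqrt (Nat.cast_nonneg _), multiPow, multiPow,
      multiFactorial, Nat.cast_prod, ← Finset.prod_mul_distrib, ← Finset.prod_div_distrib]
    simp_rw [mul_pow]
  · simp [PiLp.inner_apply, mul_comm]

/-- The square-summable sequence `p ↦ z ^ p / √(p!)`. -/
noncomputable def multiPowSeq {D : ℕ} (z : EuclideanSpace ℝ (Fin D)) :
    lp (fun _ : Fin D → ℕ => ℝ) 2 :=
  ⟨fun p => multiPow z p / √(multiFactorial p : ℝ), memℓp_gen (by
    simpa [← sq, ← abs_div] using (hasSum_multiPow_mul_multiPow z z).summable)⟩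

theorem inner_multiPowSeq_multiPowSeq {D : ℕ} (z w : EuclideanSpace ℝ (Fin D)) :
    inner ℝ (multiPowSeq z) (multiPowSeq w) = Real.exp (inner ℝ z w) := by
  rw [lp.inner_eq_tsum, ← (hasSum_multiPow_mul_multiPow z w).tsum_eq]
  exact tsum_congr fun p => mul_comm _ _

theorem inner_multiPowSeq_eq_multiSeries {D : ℕ} (z : EuclideanSpace ℝ (Fin D))
    (a : lp (fun _ : Fin D → ℕ => ℝ) 2) :
    inner ℝ (multiPowSeq z) a = multiSeries a z := by
  rw [lp.inner_eq_tsum, multiSeries]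
  refine tsum_congr fun p => ?_
  change a p * (multiPow z p / √(multiFactorial p : ℝ)) = _
  ring

/-! ### Gaussian likelihood ratios -/

open MeasureTheory

theorem continuous_gaussianModel {M N : ℕ} (H : Matrix (Fin M) (Fin N) ℝ) (σ : ℝ)
    (x : EuclideanSpace ℝ (Fin N)) : Continuous fun y => gaussianModel H σ y x := by
  unfold gaussianModel
  fun_prop

theorem gaussianModel_pos {M N : ℕ} (H : Matrix (Fin M) (Fin N) ℝ) {σ : ℝ} (hσ : 0 < σ)
    (y : EuclideanSpace ℝ (Fin M)) (x : EuclideanSpace ℝ (Fin N)) : 0 < gaussianModel H σ y x := by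
  unfold gaussianModel
  positivity

theorem integral_gaussianModel {M N : ℕ} (H : Matrix (Fin M) (Fin N) ℝ) {σ : ℝ} (hσ : 0 < σ)
    (x : EuclideanSpace ℝ (Fin N)) : ∫ y, gaussianModel H σ y x = 1 := by
  unfold gaussianModel
  rw [integral_const_mul,
    integral_sub_right_eq_self (fun y : EuclideanSpace ℝ (Fin M) =>
      Real.exp (-(1 / (2 * σ ^ 2)) * ‖y‖ ^ 2)) (matVec H x),
    GaussianFourier.integral_rexp_neg_mul_sq_norm (by positivity), finrank_euclideanSpace_fin]
  have : Real.pi / (1 / (2 * σ ^ 2)) = 2 * Real.pi * σ ^ 2 := by field_simp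
  rw [this, one_div_mul_cancel]
  positivity

theorem integrable_gaussianModel {M N : ℕ} (H : Matrix (Fin M) (Fin N) ℝ) {σ : ℝ} (hσ : 0 < σ)
    (x : EuclideanSpace ℝ (Fin N)) : Integrable fun y => gaussianModel H σ y x :=
  integrable_of_integral_eq_one (integral_gaussianModel H hσ x)

/-- Completing the square in a product of two Gaussian densities. -/
theorem gaussianModel_mul_gaussianModel {M N : ℕ} (H : Matrix (Fin M) (Fin N) ℝ) (σ : ℝ)
    (y : EuclideanSpace ℝ (Fin M)) (x₀ x₁ x₂ : EuclideanSpace ℝ (Fin N)) :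
    gaussianModel H σ y x₁ * gaussianModel H σ y x₂ =
      gaussianModel H σ y x₀ * (Real.exp (1 / σ ^ 2 * inner ℝ (matVec H x₁ - matVec H x₀)
        (matVec H x₂ - matVec H x₀)) * gaussianModel H σ y (x₁ + x₂ - x₀)) := by
  -- The point `x₁ + x₂ - x₀` makes the terms linear in `y` agree on both sides. It need not be
  -- sparse, which is harmless as the density is defined on the whole space.
  have key : ‖y - matVec H x₁‖ ^ 2 + ‖y - matVec H x₂‖ ^ 2 + 2 * inner ℝ
      (matVec H x₁ - matVec H x₀) (matVec H x₂ - matVec H x₀) = ‖y - matVec H x₀‖ ^ 2 +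
      ‖y - matVec H (x₁ + x₂ - x₀)‖ ^ 2 := by
    rw [matVec_sub, matVec_add]
    simp only [← real_inner_self_eq_norm_sq, inner_sub_left, inner_sub_right, inner_add_left,
      inner_add_right]
    linarith [real_inner_comm y (matVec H x₀), real_inner_comm y (matVec H x₁),
      real_inner_comm y (matVec H x₂), real_inner_comm (matVec H x₀) (matVec H x₁),
      real_inner_comm (matVec H x₀) (matVec H x₂), real_inner_comm (matVec H x₁) (matVec H x₂)]
  unfold gaussianModel
  set k : ℝ := 1 / (2 * Real.pi * σ ^ 2) ^ ((M : ℝ) / 2)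
  have h2 : Real.exp (-(1 / (2 * σ ^ 2)) * ‖y - matVec H x₁‖ ^ 2) *
      Real.exp (-(1 / (2 * σ ^ 2)) * ‖y - matVec H x₂‖ ^ 2) =
      Real.exp (-(1 / (2 * σ ^ 2)) * ‖y - matVec H x₀‖ ^ 2) * (Real.exp (1 / σ ^ 2 * inner ℝ
        (matVec H x₁ - matVec H x₀) (matVec H x₂ - matVec H x₀)) *
        Real.exp (-(1 / (2 * σ ^ 2)) * ‖y - matVec H (x₁ + x₂ - x₀)‖ ^ 2)) := by
    rw [← Real.exp_add, ← Real.exp_add, ← Real.exp_add]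
    congr 1
    linear_combination -(1 / (2 * σ ^ 2)) * key
  linear_combination k ^ 2 * h2

theorem integrable_observationLaw_gaussianModel_iff {M N : ℕ} (H : Matrix (Fin M) (Fin N) ℝ)
    {σ : ℝ} (hσ : 0 < σ) (x : EuclideanSpace ℝ (Fin N)) (u : EuclideanSpace ℝ (Fin M) → ℝ) :
    Integrable u (observationLaw (gaussianModel H σ) x) ↔
      Integrable fun y => gaussianModel H σ y x * u y := by
  rw [observationLaw, integrable_withDensity_iff_integrable_smul'
    (continuous_gaussianModel H σ x).measurable.ennreal_ofReal (by simp)]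
  simp [ENNReal.toReal_ofReal (gaussianModel_pos H hσ _ x).le]

theorem integral_observationLaw_gaussianModel {M N : ℕ} (H : Matrix (Fin M) (Fin N) ℝ)
    {σ : ℝ} (hσ : 0 < σ) (x : EuclideanSpace ℝ (Fin N)) (u : EuclideanSpace ℝ (Fin M) → ℝ) :
    ∫ y, u y ∂(observationLaw (gaussianModel H σ) x) = ∫ y, gaussianModel H σ y x * u y := by
  rw [observationLaw, integral_withDensity_eq_integral_toReal_smul
    (continuous_gaussianModel H σ x).measurable.ennreal_ofReal (by simp)]
  simp [ENNReal.toReal_ofReal (gaussianModel_pos H hσ _ x).le]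

theorem isProbabilityMeasure_observationLaw_gaussianModel {M N : ℕ} (H : Matrix (Fin M) (Fin N) ℝ)
    {σ : ℝ} (hσ : 0 < σ) (x : EuclideanSpace ℝ (Fin N)) :
    IsProbabilityMeasure (observationLaw (gaussianModel H σ) x) := by
  constructor
  rw [observationLaw, withDensity_apply _ MeasurableSet.univ, setLIntegral_univ,
    ← ofReal_integral_eq_lintegral_ofReal (integrable_gaussianModel H hσ x)
      (Filter.Eventually.of_forall fun y => (gaussianModel_pos H hσ y x).le),
    integral_gaussianModel H hσ x, ENNReal.ofReal_one]

/-- The likelihood ratio of the parameter `x` with respect to `x₀`. -/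
noncomputable def likelihoodRatio {M N : ℕ} (H : Matrix (Fin M) (Fin N) ℝ) (σ : ℝ)
    (x₀ x : EuclideanSpace ℝ (Fin N)) (y : EuclideanSpace ℝ (Fin M)) : ℝ :=
  gaussianModel H σ y x / gaussianModel H σ y x₀

theorem gaussianModel_mul_likelihoodRatio {M N : ℕ} (H : Matrix (Fin M) (Fin N) ℝ) {σ : ℝ}
    (hσ : 0 < σ) (x₀ x : EuclideanSpace ℝ (Fin N)) (y : EuclideanSpace ℝ (Fin M)) :
    gaussianModel H σ y x₀ * likelihoodRatio H σ x₀ x y = gaussianModel H σ y x :=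
  mul_div_cancel₀ _ (gaussianModel_pos H hσ y x₀).ne'

theorem gaussianModel_mul_likelihoodRatio_mul {M N : ℕ} (H : Matrix (Fin M) (Fin N) ℝ) {σ : ℝ}
    (hσ : 0 < σ) (x₀ x₁ x₂ : EuclideanSpace ℝ (Fin N)) (y : EuclideanSpace ℝ (Fin M)) :
    gaussianModel H σ y x₀ * (likelihoodRatio H σ x₀ x₁ y * likelihoodRatio H σ x₀ x₂ y) =
      Real.exp (1 / σ ^ 2 * inner ℝ (matVec H x₁ - matVec H x₀)
        (matVec H x₂ - matVec H x₀)) * gaussianModel H σ y (x₁ + x₂ - x₀) := by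
  have h0 := (gaussianModel_pos H hσ y x₀).ne'
  have h := gaussianModel_mul_gaussianModel H σ y x₀ x₁ x₂
  rw [likelihoodRatio, likelihoodRatio, div_mul_div_comm, h]
  field_simp

/-- The squared ratio times the density at `x₀` is a constant times the Gaussian density at `2x -
x₀`. -/
theorem memLp_likelihoodRatio {M N : ℕ} (H : Matrix (Fin M) (Fin N) ℝ) {σ : ℝ}
    (hσ : 0 < σ) (x₀ x : EuclideanSpace ℝ (Fin N)) :
    MemLp (likelihoodRatio H σ x₀ x) 2 (observationLaw (gaussianModel H σ) x₀) := by
  have hm : Measurable (likelihoodRatio H σ x₀ x) :=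
    (continuous_gaussianModel H σ x).measurable.div (continuous_gaussianModel H σ x₀).measurable
  rw [memLp_two_iff_integrable_sq hm.aestronglyMeasurable,
    integrable_observationLaw_gaussianModel_iff H hσ]
  simp_rw [sq, gaussianModel_mul_likelihoodRatio_mul H hσ]
  exact (integrable_gaussianModel H hσ _).const_mul _

theorem integral_likelihoodRatio_mul_likelihoodRatio {M N : ℕ} (H : Matrix (Fin M) (Fin N) ℝ)
    {σ : ℝ} (hσ : 0 < σ) (x₀ x₁ x₂ : EuclideanSpace ℝ (Fin N)) :
    ∫ y, likelihoodRatio H σ x₀ x₁ y * likelihoodRatio H σ x₀ x₂ y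
      ∂(observationLaw (gaussianModel H σ) x₀) = Real.exp (1 / σ ^ 2 *
        inner ℝ (matVec H x₁ - matVec H x₀) (matVec H x₂ - matVec H x₀)) := by
  rw [integral_observationLaw_gaussianModel H hσ]
  simp_rw [gaussianModel_mul_likelihoodRatio_mul H hσ]
  rw [integral_const_mul, integral_gaussianModel H hσ, mul_one]

theorem integral_likelihoodRatio_mul {M N : ℕ} (H : Matrix (Fin M) (Fin N) ℝ)
    {σ : ℝ} (hσ : 0 < σ) (x₀ x : EuclideanSpace ℝ (Fin N)) (u : EuclideanSpace ℝ (Fin M) → ℝ) :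
    ∫ y, likelihoodRatio H σ x₀ x y * u y ∂(observationLaw (gaussianModel H σ) x₀) =
      ∫ y, u y ∂(observationLaw (gaussianModel H σ) x) := by
  rw [integral_observationLaw_gaussianModel H hσ, integral_observationLaw_gaussianModel H hσ]
  simp_rw [← mul_assoc, gaussianModel_mul_likelihoodRatio H hσ]

/-- By Cauchy-Schwarz against the likelihood ratio, square integrability at `x₀` alone makes the
mean exist at every `x`. -/
theorem integrable_observationLaw_of_memLp {M N : ℕ} (H : Matrix (Fin M) (Fin N) ℝ)
    {σ : ℝ} (hσ : 0 < σ) (x₀ x : EuclideanSpace ℝ (Fin N)) {u : EuclideanSpace ℝ (Fin M) → ℝ}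
    (hu : MemLp u 2 (observationLaw (gaussianModel H σ) x₀)) :
    Integrable u (observationLaw (gaussianModel H σ) x) := by
  have h := (memLp_likelihoodRatio H hσ x₀ x).integrable_mul hu
  rw [integrable_observationLaw_gaussianModel_iff H hσ] at h ⊢
  simpa only [Pi.mul_apply, ← mul_assoc, gaussianModel_mul_likelihoodRatio H hσ] using h

/-- The likelihood ratio as an element of `L²` of the law at `x₀`. -/
noncomputable def likelihoodRatioL2 {M N : ℕ} (H : Matrix (Fin M) (Fin N) ℝ) {σ : ℝ}
    (hσ : 0 < σ) (x₀ x : EuclideanSpace ℝ (Fin N)) :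
    Lp ℝ 2 (observationLaw (gaussianModel H σ) x₀) :=
  (memLp_likelihoodRatio H hσ x₀ x).toLp _

theorem inner_likelihoodRatioL2_toLp {M N : ℕ} (H : Matrix (Fin M) (Fin N) ℝ) {σ : ℝ}
    (hσ : 0 < σ) (x₀ x : EuclideanSpace ℝ (Fin N)) {u : EuclideanSpace ℝ (Fin M) → ℝ}
    (hu : MemLp u 2 (observationLaw (gaussianModel H σ) x₀)) :
    inner ℝ (likelihoodRatioL2 H hσ x₀ x) (hu.toLp u) =
      ∫ y, likelihoodRatio H σ x₀ x y * u y ∂(observationLaw (gaussianModel H σ) x₀) := by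
  rw [L2.inner_def]
  refine integral_congr_ae ?_
  filter_upwards [(memLp_likelihoodRatio H hσ x₀ x).coeFn_toLp, hu.coeFn_toLp] with y h1 h2
  rw [likelihoodRatioL2, h1, h2]
  exact mul_comm _ _

theorem inner_likelihoodRatioL2_likelihoodRatioL2 {M N : ℕ} (H : Matrix (Fin M) (Fin N) ℝ)
    {σ : ℝ} (hσ : 0 < σ) (x₀ x₁ x₂ : EuclideanSpace ℝ (Fin N)) :
    inner ℝ (likelihoodRatioL2 H hσ x₀ x₁) (likelihoodRatioL2 H hσ x₀ x₂) = Real.exp (1 / σ ^ 2 *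
      inner ℝ (matVec H x₁ - matVec H x₀) (matVec H x₂ - matVec H x₀)) :=
  (inner_likelihoodRatioL2_toLp H hσ x₀ x₁ (memLp_likelihoodRatio H hσ x₀ x₂)).trans
    (integral_likelihoodRatio_mul_likelihoodRatio H hσ x₀ x₁ x₂)

/-! ### Valid biases as inner products -/

/-- A bias function is valid at `x₀` if and only if the corresponding mean function consists of the
inner products of the likelihood ratios with a fixed vector of `L²`. -/
theorem isValidBias_gaussianModel_iff {M N : ℕ} (H : Matrix (Fin M) (Fin N) ℝ) {σ : ℝ}
    (hσ : 0 < σ) (X : Set (EuclideanSpace ℝ (Fin N))) (g c : X → ℝ) (x₀ : X) :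
    IsValidBias X (gaussianModel H σ) g c x₀ ↔
      ∃ u : Lp ℝ 2 (observationLaw (gaussianModel H σ) (x₀ : EuclideanSpace ℝ (Fin N))),
        ∀ x : X, inner ℝ (likelihoodRatioL2 H hσ x₀ x) u = c x + g x := by
  have := isProbabilityMeasure_observationLaw_gaussianModel H hσ x₀
  constructor
  · rintro ⟨u, hm, -, hv, hb⟩
    have hu := (ProbabilityTheory.evariance_lt_top_iff_memLp hm.aestronglyMeasurable).1 hv
    refine ⟨hu.toLp u, fun x => ?_⟩
    rw [inner_likelihoodRatioL2_toLp, integral_likelihoodRatio_mul H hσ, ← hb x, sub_add_cancel]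
  · rintro ⟨v, hv⟩
    -- An estimator must be measurable everywhere, so a strongly measurable representative of the
    -- class `v` is taken.
    obtain ⟨u, hm, hvu⟩ := (Lp.aestronglyMeasurable v)
    have hu : MemLp u 2 (observationLaw (gaussianModel H σ) (x₀ : EuclideanSpace ℝ (Fin N))) :=
      (memLp_congr_ae hvu).1 (Lp.memLp v)
    have hvu' : hu.toLp u = v := by
      rw [← Lp.toLp_coeFn v (Lp.memLp v)]
      exact (MemLp.toLp_eq_toLp_iff _ _).2 hvu.symm
    refine ⟨u, hm.measurable, fun x => integrable_observationLaw_of_memLp H hσ x₀ x hu,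
      ProbabilityTheory.evariance_lt_top hu, fun x => ?_⟩
    rw [← integral_likelihoodRatio_mul H hσ x₀, ← inner_likelihoodRatioL2_toLp H hσ x₀ x hu, hvu',
      hv, add_sub_cancel_right]

theorem theorem4 {M N D S : ℕ} (hS : 1 ≤ S) (hSN : S ≤ N)
    (H : Matrix (Fin M) (Fin N) ℝ) (hspark : (S : ℕ∞) < spark H)
    (σ : ℝ) (hσ : 0 < σ)
    (U : Matrix (Fin M) (Fin D) ℝ) (s : Fin D → ℝ) (V : Matrix (Fin N) (Fin D) ℝ)
    (hsvd : IsThinSVD H U s V)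
    (g c : sparseVectors N S → ℝ) (x₀ : sparseVectors N S) :
    IsValidBias (sparseVectors N S) (gaussianModel H σ) g c x₀ ↔
      ∃ a : lp (fun _ : Fin D → ℕ => ℝ) 2, ∀ x : sparseVectors N S,
        c x =
          Real.exp (1 / (2 * σ ^ 2) * ‖matVec H x₀.1‖ ^ 2
              - 1 / σ ^ 2 * (x.1.ofLp ⬝ᵥ (H.transpose * H).mulVec x₀.1.ofLp)) *
            multiSeries a ((1 / σ) • matVec (pinv (V * (Matrix.diagonal s)⁻¹)) x.1)
          - g x := by
  set w : sparseVectors N S → EuclideanSpace ℝ (Fin D) :=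
    fun x => (1 / σ) • matVec (pinv (V * (Matrix.diagonal s)⁻¹)) x.1 with hw
  set k : sparseVectors N S → ℝ := fun x => Real.exp (1 / (2 * σ ^ 2) * ‖matVec H x₀.1‖ ^ 2
    - 1 / σ ^ 2 * (x.1.ofLp ⬝ᵥ (H.transpose * H).mulVec x₀.1.ofLp)) with hk
  -- Of the four terms of `⟨Hx₁ - Hx₀, Hx₂ - Hx₀⟩` only `⟨Hx₁, Hx₂⟩` couples the two points. The
  -- others go into `k x₁` and `k x₂`, each taking half of `‖Hx₀‖²`.
  have hgram : ∀ x₁ x₂ : sparseVectors N S,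
      inner ℝ (likelihoodRatioL2 H hσ x₀.1 x₁.1) (likelihoodRatioL2 H hσ x₀.1 x₂.1) =
        inner ℝ (k x₁ • multiPowSeq (w x₁)) (k x₂ • multiPowSeq (w x₂)) := by
    intro x₁ x₂
    rw [inner_likelihoodRatioL2_likelihoodRatioL2,
      real_inner_smul_left, real_inner_smul_right, inner_multiPowSeq_multiPowSeq, hk, hw]
    simp only
    rw [real_inner_smul_left, real_inner_smul_right, hsvd.inner_matVec_pinv,
      ← inner_matVec_matVec, ← inner_matVec_matVec, ← Real.exp_add, ← Real.exp_add,
      inner_sub_left, inner_sub_right, inner_sub_right, ← real_inner_self_eq_norm_sq,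
      real_inner_comm (matVec H x₂.1) (matVec H x₀.1)]
    congr 1
    field_simp
    ring
  rw [isValidBias_gaussianModel_iff H hσ]
  constructor
  · rintro ⟨u, hu⟩
    obtain ⟨a, ha⟩ := exists_forall_inner_eq_of_gram_eq hgram u
    refine ⟨a, fun x => ?_⟩
    rw [eq_sub_iff_add_eq, ← hu, ha, real_inner_smul_left, inner_multiPowSeq_eq_multiSeries]
  · rintro ⟨a, ha⟩
    obtain ⟨u, hu⟩ := exists_forall_inner_eq_of_gram_eq (fun x₁ x₂ => (hgram x₁ x₂).symm) a
    refine ⟨u, fun x => ?_⟩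
    rw [← hu, ha, real_inner_smul_left, inner_multiPowSeq_eq_multiSeries, sub_add_cancel]
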